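/- Corollary 1 (A Necessary and Sufficient Condition for Semantic Capacity Gain). There are $N\ge 1$ non-colluding databases, each storing the same $K\ge 1$ independent messages; message $W_i$ is uniformly distributed on $\mathbb F_s^{L_i}$, where $\mathbb F_s$ is a finite field and $L_1\ge L_2\ge\dots\ge L_K\ge 1$ are integers. The index $\theta$ of the desired message satisfies $P(\theta=i)=p_i>0$, with $\sum_{i=1}^K p_i=1$. In a retrieval scheme, a user who wants $W_i$ sends random queries $Q_1^{[i]},\dots,Q_N^{[i]}$ (discrete random variables, jointly independent of the messages), one to each database. Database $n$ returns a string $A_n^{[i]}$ of symbols of $\mathbb F_s$ which is a deterministic function of $Q_n^{[i]}$ and $(W_1,\dots,W_K)$, and whose length is determined by the query. The scheme is achievable if it is correct, i.e. $H(W_i\mid A_1^{[i]},\dots,A_N^{[i]},Q_1^{[i]},\dots,Q_N^{[i]})=0$ for all $i$, and private, i.e. for every $n$ the index $\theta$ is independent of the query received by database $n$. Its rate is $\mathbb E[L]/\mathbb E[D]$, where $\mathbb E[L]=\sum_{i=1}^K p_iL_i$ and $\mathbb E[D]$ is the expected total number of downloaded symbols, over $\theta$ and the queries. Let $C_{\rm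 exact}(L_1,\dots,L_K)$ be the supremum of the rates of all achievable schemes for the message sizes $L_1,\dots,L_K$, and let $$C=\sup_{m\ge 1} C_{\rm exact}(mL_1,\dots,mL_K)$$ be the semantic PIR capacity (the sizes may be scaled by a common integer factor). Let $C_{\rm PIR}=\left(1+\frac1N+\dots+\frac1{N^{K-1}}\right)^{-1}$ be the classical PIR capacity. Then $$C>C_{\rm PIR}\quad\Longleftrightarrow\quad \sum_{i=1}^K \frac{1}{N^{i-1}}\bigl(L_i-\mathbb E[L]\bigr)<0\quad\Longleftrightarrow\quad \sum_{i=1}^K\sum_{j=1}^K\frac{p_j}{N^{i-1}}(L_i-L_j)<0 .$$ Moreover, if all the $L_i$ are multiples of $N^K$, or all the $L_i$ are multiples of $N-1$, then the same equivalences hold with $C_{\rm exact}(L_1,\dots,L_K)$ in place of $C$. -/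

import Mathlib

open scoped ENNReal

noncomputable section

/-- The contents of the `K` messages stored (replicated) at every database: message `k` is a
string of `L k` symbols from `F`. The messages are independent and uniform, so every element of
this type occurs with the same positive probability `1 / |F| ^ ∑ k, L k`. -/
abbrev Messages (F : Type*) {K : ℕ} (L : Fin K → ℕ) : Type _ :=
  (k : Fin K) → Fin (L k) → F

/-- The data of a one-round retrieval protocol with `N` databases for messages of sizes `L`.

* `queryLaw i` is the joint law of the queries `(Q_1, …, Q_N)` sent when message `i` is desired.
  It does not involve the message contents: queries are independent of the messages.
* `answer n q w` is the answer string of database `n`, a deterministic function of the received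
  query `q` and of the stored messages `w`. It consists of `answerLength n q` symbols from `F`;
  the number of symbols may depend on the query. -/
structure RetrievalProtocol (F : Type*) (N : ℕ) {K : ℕ} (L : Fin K → ℕ) where
  Query : Type
  queryLaw : Fin K → PMF (Fin N → Query)
  answerLength : Fin N → Query → ℕ
  answer : (n : Fin N) → (q : Query) → Messages F L → Fin (answerLength n q) → F

namespace RetrievalProtocol

variable {F : Type*} {N K : ℕ} {L : Fin K → ℕ}

/-- Correctness, `H(W_i | A_1, …, A_N, Q_1, …, Q_N) = 0`: for every query vector that is used with
positive probability when message `i` is desired, the answers determine message `i`. -/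
def IsCorrect (S : RetrievalProtocol F N L) : Prop :=
  ∀ i : Fin K, ∀ q ∈ (S.queryLaw i).support, ∀ w w' : Messages F L,
    (∀ n, S.answer n (q n) w = S.answer n (q n) w') → w i = w' i

/-- `P(Q_n = q | θ = i)`: the law of the query received by database `n` when message `i` is
desired. -/
def databaseLaw (S : RetrievalProtocol F N L) (i : Fin K) (n : Fin N) : PMF S.Query :=
  (S.queryLaw i).map fun q => q n

/-- Privacy: the desired index `θ`, of law `p`, is independent of the query received by any single
database, that is `P(θ = i, Q_n = q) = P(θ = i) * P(Q_n = q)`. -/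
def IsPrivate (S : RetrievalProtocol F N L) (p : Fin K → ℝ) : Prop :=
  ∀ (n : Fin N) (i : Fin K) (q : S.Query),
    p i * (S.databaseLaw i n q).toReal =
      p i * ∑ j, p j * (S.databaseLaw j n q).toReal

/-- `E[D]`: the expected total number of downloaded symbols, over the desired index (of law `p`)
and the random queries. -/
def expectedDownload (S : RetrievalProtocol F N L) (p : Fin K → ℝ) : ℝ≥0∞ :=
  ∑ i, ENNReal.ofReal (p i) *
    ∑' q : Fin N → S.Query, S.queryLaw i q * ∑ n, (S.answerLength n (q n) : ℝ≥0∞)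

end RetrievalProtocol

/-- `E[L]`: the expected size of the desired message. -/
def expectedSize {K : ℕ} (p : Fin K → ℝ) (L : Fin K → ℕ) : ℝ :=
  ∑ i, p i * (L i : ℝ)

/-- The supremum of the rates `E[L] / E[D]` over all correct and private protocols for messages
whose sizes are exactly `L`. -/
def exactSizeCapacity (F : Type*) (N : ℕ) {K : ℕ} (p : Fin K → ℝ) (L : Fin K → ℕ) : ℝ≥0∞ :=
  ⨆ (S : RetrievalProtocol F N L) (_ : S.IsCorrect) (_ : S.IsPrivate p),
    ENNReal.ofReal (expectedSize p L) / S.expectedDownload p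

/-- The semantic PIR capacity for priors `p` and message sizes in the proportion `L`: the supremum
of the rates over all correct and private protocols, where all sizes may be multiplied by a common
positive integer `m` (the messages are made of `m` blocks), so that the capacity is not affected
by divisibility of the sizes. -/
def semanticCapacity (F : Type*) (N : ℕ) {K : ℕ} (p : Fin K → ℝ) (L : Fin K → ℕ) : ℝ≥0∞ :=
  ⨆ (m : ℕ) (_ : 0 < m), exactSizeCapacity F N p fun i => m * L i

/-- The classical PIR capacity `(1 + 1/N + ⋯ + 1/N^(K-1))⁻¹`. -/
def classicalCapacity (N K : ℕ) : ℝ :=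
  (∑ i ∈ Finset.range K, 1 / (N : ℝ) ^ i)⁻¹

end

/-! Everything follows from the capacity formula C = E[L] / D, where D = ∑ L_i / N^i with messages
indexed from 0. Given it, C > C_PIR is a comparison of two fractions with positive denominators, and
L_i - E[L] = ∑_j p_j (L_i - L_j) gives the double-sum form.

Converse (`sum_div_pow_le_expectedDownload`): let H_j(i) be the mean entropy of the answers for
desired message j, given the messages of index below i. Correctness gives H_i(i) = L_i log|F| +
H_i(i+1) (`answerEntropy_self`). Privacy and subadditivity give H_{i+1}(i+1) ≤ N H_i(i+1)
(`answerEntropy_le_mul`). Unrolling yields H_0(0) ≥ D log|F|, while H_0(0) is at most log|F| times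
the expected download.

Achievability: queries consist of items, each asking for a sum of at most one symbol per message,
blockwise with shorter messages padded by zeros. A symbol of the desired message is the difference
of two items with the same interference. An item costs the block count of its longest, hence first,
message, so only the frequency of each leading message matters; `le_exactSizeCapacity_of_items`
turns these requirements into a capacity bound. Two families attain D: random vectors shifted
cyclically, for sizes divisible by N - 1, and normalized vectors over Z/N, for sizes divisible by
N^(K-1). Scaling the sizes by N^K makes the second apply to C for arbitrary sizes. -/

/-! ### Conditional entropy under a uniform law, by counting fibres. -/

section Entropy

variable {Ω : Type*} [Fintype Ω] {β γ δ : Type*}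

open Classical in
/-- The number of outcomes on which `f` takes the same value as at `ω`. -/
noncomputable def fiberCard (f : Ω → β) (ω : Ω) : ℕ :=
  (Finset.univ.filter fun ω' => f ω' = f ω).card

/-- The conditional entropy `H(f | g)` (in nats) for the uniform distribution on `Ω`. -/
noncomputable def condEntropy (f : Ω → β) (g : Ω → γ) : ℝ :=
  (∑ ω, (Real.log (fiberCard g ω) - Real.log (fiberCard (fun ω => (f ω, g ω)) ω))) /
    Fintype.card Ω

lemma fiberCard_pos (f : Ω → β) (ω : Ω) : 0 < fiberCard f ω :=
  Finset.card_pos.mpr ⟨ω, by simp⟩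

lemma fiberCard_eq_of_eq {f : Ω → β} {ω ω' : Ω} (h : f ω = f ω') :
    fiberCard f ω = fiberCard f ω' := by
  rw [fiberCard, fiberCard, h]

lemma fiberCard_anti {f : Ω → β} {g : Ω → γ} (h : ∀ ω ω', f ω = f ω' → g ω = g ω') (ω : Ω) :
    fiberCard f ω ≤ fiberCard g ω := by
  classical
  refine Finset.card_le_card fun ω' hω' => ?_
  simp only [Finset.mem_filter, Finset.mem_univ, true_and] at hω' ⊢
  exact h _ _ hω'

lemma condEntropy_nonneg (f : Ω → β) (g : Ω → γ) : 0 ≤ condEntropy f g := by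
  refine div_nonneg (Finset.sum_nonneg fun ω _ => sub_nonneg.mpr ?_) (Nat.cast_nonneg _)
  refine Real.log_le_log (by exact_mod_cast fiberCard_pos _ _) ?_
  exact_mod_cast fiberCard_anti (fun ω ω' h => (Prod.ext_iff.mp h).2) ω

/-- If `f` determines `f'`, then `H(f' | g) ≤ H(f | g)`. -/
lemma condEntropy_mono {f : Ω → β} {f' : Ω → δ} (g : Ω → γ)
    (h : ∀ ω ω', f ω = f ω' → f' ω = f' ω') : condEntropy f' g ≤ condEntropy f g := by
  refine div_le_div_of_nonneg_right (Finset.sum_le_sum fun ω _ => ?_) (Nat.cast_nonneg _)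
  refine sub_le_sub_left (Real.log_le_log (by exact_mod_cast fiberCard_pos _ _) ?_) _
  have := fiberCard_anti (f := fun ω => (f ω, g ω)) (g := fun ω => (f' ω, g ω))
    (fun ω ω' hω => Prod.ext (h _ _ (Prod.ext_iff.mp hω).1) (Prod.ext_iff.mp hω).2) ω
  exact_mod_cast this

lemma sum_inv_fiberCard_le_one (f : Ω → β) (b : β) [DecidablePred fun ω => f ω = b] :
    ∑ ω with f ω = b, (1 / (fiberCard f ω : ℝ)) ≤ 1 := by
  have h : ∀ ω ∈ Finset.univ.filter (fun ω => f ω = b),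
      (1 / (fiberCard f ω : ℝ)) = 1 / ((Finset.univ.filter fun ω => f ω = b).card : ℝ) := by
    intro ω hω
    rw [fiberCard, (Finset.mem_filter.mp hω).2]
    congr!
  rw [Finset.sum_congr rfl h, Finset.sum_const, nsmul_eq_mul, mul_one_div]
  exact div_self_le_one _

/-- `H(f | g)` is at most the logarithm of the size of the range type of `f`. -/
lemma condEntropy_le_log_card [Fintype β] [Nonempty Ω] (f : Ω → β) (g : Ω → γ) :
    condEntropy f g ≤ Real.log (Fintype.card β) := by
  classical
  have hΩ : (0 : ℝ) < Fintype.card Ω := by exact_mod_cast Fintype.card_pos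
  have : Nonempty β := ⟨f (Classical.arbitrary Ω)⟩
  have hβ : (0 : ℝ) < Fintype.card β := by exact_mod_cast Fintype.card_pos
  have hpos : ∀ ω, (0 : ℝ) < fiberCard g ω := fun ω => by exact_mod_cast fiberCard_pos _ _
  have hpos' : ∀ ω, (0 : ℝ) < fiberCard (fun ω => (f ω, g ω)) ω :=
    fun ω => by exact_mod_cast fiberCard_pos _ _
  rw [condEntropy, div_le_iff₀ hΩ]
  -- Jensen's inequality is replaced by log x ≤ x - 1, which leaves this count: for each `a` and
  -- each value `b`, the outcomes with `f = b` in the `g`-fibre of `a` have total weight at most 1.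
  have hsum : ∑ ω, (fiberCard g ω : ℝ) / fiberCard (fun ω => (f ω, g ω)) ω ≤
      Fintype.card Ω * Fintype.card β := by
    calc ∑ ω, (fiberCard g ω : ℝ) / fiberCard (fun ω => (f ω, g ω)) ω
        = ∑ ω, ∑ a, if g a = g ω then 1 / (fiberCard (fun ω => (f ω, g ω)) ω : ℝ) else 0 := by
          refine Finset.sum_congr rfl fun ω _ => ?_
          rw [← Finset.sum_filter, Finset.sum_const, nsmul_eq_mul, mul_one_div]
          rfl
      _ = ∑ a, ∑ ω, ∑ b, if (f ω, g ω) = (b, g a) then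
            1 / (fiberCard (fun ω => (f ω, g ω)) ω : ℝ) else 0 := by
          rw [Finset.sum_comm]
          refine Finset.sum_congr rfl fun a _ => Finset.sum_congr rfl fun ω _ => ?_
          simp only [Prod.mk.injEq, ite_and, Finset.sum_ite_eq, Finset.mem_univ, if_true]
          simp [eq_comm]
      _ ≤ ∑ a : Ω, ∑ b : β, (1 : ℝ) := by
          refine Finset.sum_le_sum fun a _ => ?_
          rw [Finset.sum_comm]
          refine Finset.sum_le_sum fun b _ => ?_
          rw [← Finset.sum_filter]
          exact sum_inv_fiberCard_le_one (fun ω => (f ω, g ω)) (b, g a)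
      _ = _ := by simp
  have hlog : ∀ ω, Real.log (fiberCard g ω) - Real.log (fiberCard (fun ω => (f ω, g ω)) ω) ≤
      Real.log (Fintype.card β) +
        (((fiberCard g ω : ℝ) / fiberCard (fun ω => (f ω, g ω)) ω) / Fintype.card β - 1) := by
    intro ω
    have := Real.log_le_sub_one_of_pos (div_pos (div_pos (hpos ω) (hpos' ω)) hβ)
    rw [Real.log_div (div_pos (hpos ω) (hpos' ω)).ne' hβ.ne',
      Real.log_div (hpos ω).ne' (hpos' ω).ne'] at this
    linarith
  refine (Finset.sum_le_sum fun ω _ => hlog ω).trans ?_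
  rw [Finset.sum_add_distrib, Finset.sum_sub_distrib, ← Finset.sum_div]
  have := (div_le_iff₀ hβ).mpr hsum
  simp only [Finset.sum_const, Finset.card_univ, nsmul_eq_mul, mul_one]
  linarith

/-- Conditional entropy is subadditive. -/
lemma condEntropy_prod_le (f : Ω → β) (f' : Ω → δ) (g : Ω → γ) :
    condEntropy (fun ω => (f ω, f' ω)) g ≤ condEntropy f g + condEntropy f' g := by
  classical
  rw [condEntropy, condEntropy, condEntropy, ← add_div, ← Finset.sum_add_distrib]
  refine div_le_div_of_nonneg_right ?_ (Nat.cast_nonneg _)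
  set c : Ω → ℝ := fun ω => fiberCard g ω with hc
  set x : Ω → ℝ := fun ω => fiberCard (fun ω => (f ω, g ω)) ω with hx
  set y : Ω → ℝ := fun ω => fiberCard (fun ω => (f' ω, g ω)) ω with hy
  set z : Ω → ℝ := fun ω => fiberCard (fun ω => ((f ω, f' ω), g ω)) ω with hz
  have hc0 : ∀ ω, 0 < c ω := fun ω => by simp only [hc]; exact_mod_cast fiberCard_pos _ _
  have hx0 : ∀ ω, 0 < x ω := fun ω => by simp only [hx]; exact_mod_cast fiberCard_pos _ _
  have hy0 : ∀ ω, 0 < y ω := fun ω => by simp only [hy]; exact_mod_cast fiberCard_pos _ _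
  have hz0 : ∀ ω, 0 < z ω := fun ω => by simp only [hz]; exact_mod_cast fiberCard_pos _ _
  have hlog : ∀ ω, Real.log (c ω) - Real.log (z ω) ≤
      (Real.log (c ω) - Real.log (x ω) + (Real.log (c ω) - Real.log (y ω))) +
        (x ω * y ω / (z ω * c ω) - 1) := by
    intro ω
    have := Real.log_le_sub_one_of_pos
      (div_pos (mul_pos (hx0 ω) (hy0 ω)) (mul_pos (hz0 ω) (hc0 ω)))
    rw [Real.log_div (mul_pos (hx0 ω) (hy0 ω)).ne' (mul_pos (hz0 ω) (hc0 ω)).ne',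
      Real.log_mul (hx0 ω).ne' (hy0 ω).ne', Real.log_mul (hz0 ω).ne' (hc0 ω).ne'] at this
    linarith
  -- Expanding `x` and `y` as counts turns the sum into one over pairs `(a, b)` in a common
  -- `g`-fibre. For a fixed pair the weights `1 / z ω` add up to at most 1, and the remaining `1 / c
  -- a`, summed over `b`, gives 1 for each `a`.
  have hsum : ∑ ω, x ω * y ω / (z ω * c ω) ≤ ∑ ω : Ω, 1 := by
    have hx' : ∀ ω, x ω = ∑ a, if (f a, g a) = (f ω, g ω) then (1 : ℝ) else 0 := fun ω => by
      simp [hx, fiberCard]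
    have hy' : ∀ ω, y ω = ∑ b, if (f' b, g b) = (f' ω, g ω) then (1 : ℝ) else 0 := fun ω => by
      simp [hy, fiberCard]
    have hc' : ∀ ω, c ω = ∑ b, if g b = g ω then (1 : ℝ) else 0 := fun ω => by
      simp [hc, fiberCard]
    calc ∑ ω, x ω * y ω / (z ω * c ω)
        = ∑ ω, ∑ a, ∑ b, if g b = g a then
            (if ((f ω, f' ω), g ω) = ((f a, f' b), g a) then 1 / z ω else 0) / c a else 0 := by
          refine Finset.sum_congr rfl fun ω _ => ?_
          rw [hx', hy', Finset.sum_mul_sum, Finset.sum_div]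
          refine Finset.sum_congr rfl fun a _ => ?_
          rw [Finset.sum_div]
          refine Finset.sum_congr rfl fun b _ => ?_
          by_cases h1 : f a = f ω ∧ g a = g ω
          · have hca : c a = c ω := by simp only [hc]; rw [fiberCard_eq_of_eq h1.2]
            by_cases h2 : f' b = f' ω ∧ g b = g ω
            · simp [h1.1, h1.2, h2.1, h2.2, hca]; field_simp
            · have h2' : ¬ (g b = g a ∧ f' ω = f' b) := by
                rw [h1.2]; exact fun h => h2 ⟨h.2.symm, h.1⟩
              rw [if_neg (c := (f' b, g b) = (f' ω, g ω)) (by simpa using h2)]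
              by_cases h3 : g b = g a
              · have : ¬ f' ω = f' b := fun h => h2' ⟨h3, h⟩
                simp [this]
              · simp [h3]
          · have : ¬ (((f ω, f' ω), g ω) = ((f a, f' b), g a)) := by
              simp only [Prod.mk.injEq]
              exact fun h => h1 ⟨h.1.1.symm, h.2.symm⟩
            rw [if_neg (by simpa using h1), if_neg this]; simp
      _ = ∑ a, ∑ b, if g b = g a then
            (∑ ω with ((f ω, f' ω), g ω) = ((f a, f' b), g a), 1 / z ω) / c a else 0 := by
          rw [Finset.sum_comm]
          refine Finset.sum_congr rfl fun a _ => ?_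
          rw [Finset.sum_comm]
          refine Finset.sum_congr rfl fun b _ => ?_
          split_ifs with h
          · rw [Finset.sum_filter, Finset.sum_div]
          · simp
      _ ≤ ∑ a, ∑ b, if g b = g a then 1 / c a else 0 := by
          refine Finset.sum_le_sum fun a _ => Finset.sum_le_sum fun b _ => ?_
          split_ifs with h
          · exact div_le_div_of_nonneg_right
              (sum_inv_fiberCard_le_one (fun ω => ((f ω, f' ω), g ω)) ((f a, f' b), g a))
              (hc0 a).le
          · exact le_rfl
      _ = _ := by
          refine Finset.sum_congr rfl fun a _ => ?_
          rw [← Finset.sum_filter, Finset.sum_const, nsmul_eq_mul]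
          exact mul_one_div_cancel (hc0 a).ne'
  refine (Finset.sum_le_sum fun ω _ => hlog ω).trans ?_
  rw [Finset.sum_add_distrib, Finset.sum_sub_distrib]
  linarith

lemma condEntropy_pi_le {ι : Type*} [Fintype ι] {β : ι → Type*} (f : (n : ι) → Ω → β n)
    (g : Ω → γ) :
    condEntropy (fun ω n => f n ω) g ≤ ∑ n, condEntropy (f n) g := by
  classical
  have key : ∀ s : Finset ι,
      condEntropy (fun ω (n : s) => f n ω) g ≤ ∑ n ∈ s, condEntropy (f n) g := by
    intro s
    induction s using Finset.induction_on with
    | empty =>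
      refine (div_nonpos_of_nonpos_of_nonneg (Finset.sum_nonpos fun ω _ => sub_nonpos.mpr
        (Real.log_le_log (by exact_mod_cast fiberCard_pos _ _) ?_)) (Nat.cast_nonneg _)).trans_eq
        (by simp)
      have := fiberCard_anti (f := g)
        (g := fun ω => ((fun n : (∅ : Finset ι) => f n ω), g ω))
        (fun ω ω' h => Prod.ext (Subsingleton.elim _ _) h) ω
      exact_mod_cast this
    | insert a s ha ih =>
      rw [Finset.sum_insert ha]
      refine le_trans ?_ ((condEntropy_prod_le (f a) (fun ω (n : s) => f n ω) g).trans
        (add_le_add_right ih _))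
      refine condEntropy_mono g fun ω ω' h => ?_
      simp only [Prod.mk.injEq, funext_iff, Subtype.forall] at h ⊢
      intro n hn
      rcases Finset.mem_insert.mp hn with rfl | hn
      · exact h.1
      · exact h.2 n hn
  refine le_trans (condEntropy_mono g fun ω ω' h => ?_) (key Finset.univ)
  simp only [funext_iff, Subtype.forall] at h ⊢
  exact fun n => h n (Finset.mem_univ n)

/-- If `f` and `g` determine `g'`, then passing from `H(f | g)` to `H(f | g, g')` loses exactly
the entropy of `g'` given `g`; here `g'` refines `g` by a constant factor. -/
lemma condEntropy_eq_log_add [Nonempty Ω] {f : Ω → β} {g : Ω → γ} {g' : Ω → δ} {c : ℕ}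
    (hg : ∀ ω ω', g' ω = g' ω' → g ω = g ω')
    (hf : ∀ ω ω', f ω = f ω' → g ω = g ω' → g' ω = g' ω')
    (hc : ∀ ω, fiberCard g ω = c * fiberCard g' ω) :
    condEntropy f g = Real.log c + condEntropy f g' := by
  have hΩ : (Fintype.card Ω : ℝ) ≠ 0 := by exact_mod_cast Fintype.card_ne_zero
  have h : ∀ ω, Real.log (fiberCard g ω) - Real.log (fiberCard (fun ω => (f ω, g ω)) ω) =
      Real.log c +
        (Real.log (fiberCard g' ω) - Real.log (fiberCard (fun ω => (f ω, g' ω)) ω)) := by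
    intro ω
    -- The pairs `(f, g)` and `(f, g')` determine each other, so only the conditioning fibre changes
    -- size.
    have h1 : fiberCard (fun ω => (f ω, g ω)) ω = fiberCard (fun ω => (f ω, g' ω)) ω := by
      refine le_antisymm (fiberCard_anti (fun ω ω' h => ?_) ω)
        (fiberCard_anti (fun ω ω' h => ?_) ω)
      · obtain ⟨h1, h2⟩ := Prod.ext_iff.mp h
        exact Prod.ext h1 (hf _ _ h1 h2)
      · obtain ⟨h1, h2⟩ := Prod.ext_iff.mp h
        exact Prod.ext h1 (hg _ _ h2)
    have hpos := fiberCard_pos g ω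
    rw [hc] at hpos
    rw [h1, hc ω, Nat.cast_mul, Real.log_mul]
    · ring
    · exact_mod_cast (Nat.pos_of_mul_pos_right hpos).ne'
    · exact_mod_cast (fiberCard_pos g' ω).ne'
  rw [condEntropy, condEntropy, Finset.sum_congr rfl fun ω _ => h ω, Finset.sum_add_distrib,
    add_div]
  simp [hΩ]

end Entropy

/-! ### Consequences of privacy for the law of a single query. -/

section Queries

variable {F : Type*} {N K : ℕ} {L : Fin K → ℕ}

lemma tsum_pmf_map_mul {α β : Type*} (P : PMF α) (f : α → β) (φ : β → ℝ≥0∞) :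
    ∑' b, (P.map f) b * φ b = ∑' a, P a * φ (f a) := by
  classical
  simp only [PMF.map_apply, ← ENNReal.tsum_mul_right]
  rw [ENNReal.tsum_comm]
  refine tsum_congr fun a => ?_
  rw [tsum_eq_single (f a)]
  · simp
  · intro b hb
    simp [hb]

/-- Independence makes each conditional law equal to the same mixture once the positive prior is
cancelled. -/
lemma databaseLaw_eq {S : RetrievalProtocol F N L} {p : Fin K → ℝ} (hp : ∀ i, 0 < p i)
    (hS : S.IsPrivate p) (i j : Fin K) (n : Fin N) : S.databaseLaw i n = S.databaseLaw j n := by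
  ext q
  have hi := mul_left_cancel₀ (hp i).ne' (hS n i q)
  have hj := mul_left_cancel₀ (hp j).ne' (hS n j q)
  exact (ENNReal.toReal_eq_toReal_iff' (PMF.apply_ne_top _ _) (PMF.apply_ne_top _ _)).mp
    (hi.trans hj.symm)

/-- In a private protocol, functions of the query to one database have the same mean whichever
message is desired. -/
lemma tsum_queryLaw_eq {S : RetrievalProtocol F N L} {p : Fin K → ℝ} (hp : ∀ i, 0 < p i)
    (hS : S.IsPrivate p) (i j : Fin K) (n : Fin N) (φ : S.Query → ℝ≥0∞) :
    ∑' q, S.queryLaw i q * φ (q n) = ∑' q, S.queryLaw j q * φ (q n) := by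
  rw [← tsum_pmf_map_mul (S.queryLaw i) (fun q => q n) φ,
    ← tsum_pmf_map_mul (S.queryLaw j) (fun q => q n) φ]
  change ∑' b, S.databaseLaw i n b * φ b = ∑' b, S.databaseLaw j n b * φ b
  rw [databaseLaw_eq hp hS i j n]

lemma tsum_mul_finset_sum {α ι : Type*} [Fintype ι] (P : α → ℝ≥0∞) (f : ι → α → ℝ≥0∞) :
    ∑' a, P a * ∑ n, f n a = ∑ n, ∑' a, P a * f n a := by
  rw [← Summable.tsum_finsetSum fun _ _ => ENNReal.summable]
  simp only [Finset.mul_sum]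

/-- Each answer length depends on one database's query alone, so its mean is the same for every
desired message and averaging over the prior is harmless. -/
lemma expectedDownload_eq {S : RetrievalProtocol F N L} {p : Fin K → ℝ} (hp : ∀ i, 0 < p i)
    (hp1 : ∑ i, p i = 1) (hS : S.IsPrivate p) (i : Fin K) :
    S.expectedDownload p =
      ∑' q : Fin N → S.Query, S.queryLaw i q * ∑ n, (S.answerLength n (q n) : ℝ≥0∞) := by
  have h : ∀ j, ∑' q : Fin N → S.Query, S.queryLaw j q * ∑ n, (S.answerLength n (q n) : ℝ≥0∞) =
      ∑' q : Fin N → S.Query, S.queryLaw i q * ∑ n, (S.answerLength n (q n) : ℝ≥0∞) := by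
    intro j
    rw [tsum_mul_finset_sum, tsum_mul_finset_sum]
    exact Finset.sum_congr rfl fun n _ =>
      tsum_queryLaw_eq hp hS j i n fun x => (S.answerLength n x : ℝ≥0∞)
  rw [RetrievalProtocol.expectedDownload, Finset.sum_congr rfl fun j _ => by rw [h j],
    ← Finset.sum_mul, ← ENNReal.ofReal_sum_of_nonneg fun j _ => (hp j).le, hp1]
  simp

lemma isPrivate_of_databaseLaw_eq {L : Fin K → ℕ} {S : RetrievalProtocol F N L} {p : Fin K → ℝ}
    (hp1 : ∑ i, p i = 1) (h : ∀ i j n, S.databaseLaw i n = S.databaseLaw j n) :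
    S.IsPrivate p := by
  intro n i q
  rw [Finset.sum_congr rfl fun j _ => by rw [h j i n], ← Finset.sum_mul, hp1, one_mul]

end Queries

/-! ### The lower bound on the download. -/

section Converse

variable {F : Type*} {N K : ℕ} {L : Fin K → ℕ}

/-- The restriction of the messages to those of index less than `i`. -/
def messagesBelow (i : ℕ) (w : Messages F L) (k : {k : Fin K // (k : ℕ) < i}) : Fin (L k) → F :=
  w k

lemma fiberCard_messagesBelow [Fintype F] (i : ℕ) (w : Messages F L) :
    fiberCard (messagesBelow (F := F) (L := L) i) w =
      ∏ k : Fin K, if (k : ℕ) < i then 1 else Fintype.card F ^ L k := by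
  classical
  have : (Finset.univ.filter fun w' : Messages F L => messagesBelow i w' = messagesBelow i w) =
      Fintype.piFinset fun k : Fin K => if (k : ℕ) < i then {w k} else Finset.univ := by
    ext w'
    simp only [Finset.mem_filter, Finset.mem_univ, true_and, Fintype.mem_piFinset, funext_iff,
      messagesBelow, Subtype.forall]
    refine ⟨fun h k => ?_, fun h k hk => ?_⟩
    · split_ifs with hk
      · simpa [funext_iff] using h k hk
      · simp
    · simpa [hk, funext_iff] using h k
  rw [fiberCard]
  refine (Eq.trans (by congr!)
    ((congrArg Finset.card this).trans (Fintype.card_piFinset _))).trans ?_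
  refine Finset.prod_congr rfl fun k _ => ?_
  split_ifs <;> simp

lemma fiberCard_messagesBelow_succ [Fintype F] (i : Fin K) (w : Messages F L) :
    fiberCard (messagesBelow (F := F) (L := L) i) w =
      Fintype.card F ^ L i * fiberCard (messagesBelow (F := F) (L := L) (i + 1)) w := by
  rw [fiberCard_messagesBelow, fiberCard_messagesBelow]
  have : Fintype.card F ^ L i = ∏ k : Fin K, if k = i then Fintype.card F ^ L k else 1 := by
    simp
  rw [this, ← Finset.prod_mul_distrib]
  refine Finset.prod_congr rfl fun k _ => ?_
  by_cases h : k = i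
  · simp [h]
  · have h' : (k : ℕ) ≠ i := fun h' => h (Fin.ext h')
    by_cases h2 : (k : ℕ) < i
    · simp [h, h2, show (k : ℕ) < i + 1 by omega]
    · simp [h, h2, show ¬ (k : ℕ) < i + 1 by omega]

/-- The mean, over the queries for message `j`, of the entropy of all answers given the messages
of index less than `i`. -/
noncomputable def answerEntropy [Fintype F] (S : RetrievalProtocol F N L) (j : Fin K) (i : ℕ) :
    ℝ≥0∞ :=
  ∑' q, S.queryLaw j q * ENNReal.ofReal
    (condEntropy (fun w n => S.answer n (q n) w) (messagesBelow (F := F) (L := L) i))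

/-- The answers determine message `i`, so revealing it in the conditioning removes exactly its own
entropy; it is uniform and independent of the earlier messages. Query vectors outside the support
have weight zero, so correctness is not needed there. -/
lemma answerEntropy_self [Fintype F] [Nonempty F] {S : RetrievalProtocol F N L}
    (hS : S.IsCorrect) (i : Fin K) :
    answerEntropy S i i =
      ENNReal.ofReal (L i * Real.log (Fintype.card F)) + answerEntropy S i (i + 1) := by
  have hF : 0 ≤ (L i : ℝ) * Real.log (Fintype.card F) :=
    mul_nonneg (Nat.cast_nonneg _) (Real.log_natCast_nonneg _)
  have hone : ENNReal.ofReal (L i * Real.log (Fintype.card F)) =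
      ∑' q, S.queryLaw i q * ENNReal.ofReal (L i * Real.log (Fintype.card F)) := by
    rw [ENNReal.tsum_mul_right, PMF.tsum_coe, one_mul]
  rw [hone, answerEntropy, answerEntropy, ← ENNReal.tsum_add]
  refine tsum_congr fun q => ?_
  by_cases hq : q ∈ (S.queryLaw i).support
  · rw [← mul_add, ← ENNReal.ofReal_add hF (condEntropy_nonneg _ _)]
    rw [condEntropy_eq_log_add (g := messagesBelow (F := F) (L := L) i)
      (g' := messagesBelow (F := F) (L := L) (i + 1)) (c := Fintype.card F ^ L i) ?_ ?_
      (fiberCard_messagesBelow_succ i)]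
    · simp
    · intro w w' h
      funext k
      exact congrFun h ⟨k, by have := k.2; omega⟩
    · intro w w' h h'
      funext ⟨k, hk⟩
      rcases Nat.lt_succ_iff_lt_or_eq.mp hk with hk | hk
      · exact congrFun h' ⟨k, hk⟩
      · obtain rfl := Fin.ext hk
        exact hS k q hq w w' fun n => congrFun h n
  · have : S.queryLaw i q = 0 := by simpa [PMF.mem_support_iff] using hq
    simp [this]

/-- Split the joint entropy by databases. Each term sees only one query, so privacy exchanges the
desired message, and a single answer carries no more entropy than all of them. -/
lemma answerEntropy_le_mul [Fintype F] {S : RetrievalProtocol F N L}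
    {p : Fin K → ℝ} (hp : ∀ i, 0 < p i) (hS : S.IsPrivate p) (j j' : Fin K) (i : ℕ) :
    answerEntropy S j' i ≤ N * answerEntropy S j i := by
  calc answerEntropy S j' i
      ≤ ∑' q, S.queryLaw j' q * ∑ n, ENNReal.ofReal
          (condEntropy (S.answer n (q n)) (messagesBelow (F := F) (L := L) i)) := by
        refine ENNReal.tsum_le_tsum fun q => mul_le_mul_right ?_ _
        rw [← ENNReal.ofReal_sum_of_nonneg fun n _ => condEntropy_nonneg _ _]
        exact ENNReal.ofReal_le_ofReal (condEntropy_pi_le (fun n => S.answer n (q n)) _)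
    _ = ∑ n, ∑' q, S.queryLaw j q * ENNReal.ofReal
          (condEntropy (S.answer n (q n)) (messagesBelow (F := F) (L := L) i)) := by
        rw [tsum_mul_finset_sum]
        exact Finset.sum_congr rfl fun n _ => tsum_queryLaw_eq hp hS j' j n fun x =>
          ENNReal.ofReal (condEntropy (S.answer n x) (messagesBelow (F := F) (L := L) i))
    _ ≤ ∑ _n : Fin N, answerEntropy S j i := by
        refine Finset.sum_le_sum fun n _ => ENNReal.tsum_le_tsum fun q =>
          mul_le_mul_right (ENNReal.ofReal_le_ofReal (condEntropy_mono _ fun w w' h => ?_)) _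
        exact congrFun h n
    _ = N * answerEntropy S j i := by simp

/-- The part of the optimal download `∑ j, L j / N ^ j` that is due to the messages from `i` on. -/
noncomputable def downloadTail (N : ℕ) (L : Fin K → ℕ) (i : ℕ) : ℝ :=
  ∑ j : Fin K, if i ≤ (j : ℕ) then (L j : ℝ) / (N : ℝ) ^ (j : ℕ) else 0

lemma downloadTail_nonneg (i : ℕ) : 0 ≤ downloadTail N L i :=
  Finset.sum_nonneg fun j _ => by split_ifs <;> positivity

lemma downloadTail_eq_add (i : Fin K) :
    downloadTail N L i = L i / (N : ℝ) ^ (i : ℕ) + downloadTail N L (i + 1) := by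
  have : (L i : ℝ) / (N : ℝ) ^ (i : ℕ) =
      ∑ j : Fin K, if j = i then (L j : ℝ) / (N : ℝ) ^ (j : ℕ) else 0 := by simp
  rw [this, downloadTail, downloadTail, ← Finset.sum_add_distrib]
  refine Finset.sum_congr rfl fun k _ => ?_
  by_cases h : k = i
  · simp [h]
  · have h' : (k : ℕ) ≠ i := fun h' => h (Fin.ext h')
    by_cases h2 : (i : ℕ) ≤ k
    · simp [h, h2, show (i : ℕ) + 1 ≤ k by omega]
    · simp [h, h2, show ¬ (i : ℕ) + 1 ≤ k by omega]

/-- The recursion for the tail, scaled by `N ^ i` so that the induction below needs no division in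
`ℝ≥0∞`. -/
lemma ofReal_downloadTail_mul [Fintype F] (hN : 1 ≤ N) (i : Fin K) :
    ENNReal.ofReal (downloadTail N L i * Real.log (Fintype.card F)) * N ^ (i : ℕ) =
      ENNReal.ofReal (L i * Real.log (Fintype.card F)) +
        ENNReal.ofReal (downloadTail N L (i + 1) * Real.log (Fintype.card F)) * N ^ (i : ℕ) := by
  have hN0 : (0 : ℝ) < N := by exact_mod_cast hN
  have hlog : 0 ≤ Real.log (Fintype.card F) := Real.log_natCast_nonneg _
  have hcast : (N : ℝ≥0∞) ^ (i : ℕ) = ENNReal.ofReal ((N : ℝ) ^ (i : ℕ)) := by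
    rw [ENNReal.ofReal_pow hN0.le, ENNReal.ofReal_natCast]
  have h0 := downloadTail_nonneg (N := N) (L := L) (i + 1)
  rw [hcast, ← ENNReal.ofReal_mul (mul_nonneg (downloadTail_nonneg _) hlog),
    ← ENNReal.ofReal_mul (mul_nonneg h0 hlog), ← ENNReal.ofReal_add (by positivity)
      (by positivity), downloadTail_eq_add]
  congr 1
  field_simp

/-- Induction from the last message down, with `d` the number of messages after `i`: each step
alternates the gain of `answerEntropy_self` with the loss of a factor `N` in `answerEntropy_le_mul`.
-/
lemma downloadTail_le_answerEntropy [Fintype F] [Nonempty F] (hN : 1 ≤ N)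
    {S : RetrievalProtocol F N L} {p : Fin K → ℝ} (hp : ∀ i, 0 < p i) (hS : S.IsPrivate p)
    (hS' : S.IsCorrect) (d : ℕ) (i : Fin K) (hd : (i : ℕ) + d + 1 = K) :
    ENNReal.ofReal (downloadTail N L i * Real.log (Fintype.card F)) * N ^ (i : ℕ) ≤
      answerEntropy S i i := by
  induction d generalizing i with
  | zero =>
    rw [ofReal_downloadTail_mul hN, answerEntropy_self hS']
    have : downloadTail N L (i + 1) = 0 :=
      Finset.sum_eq_zero fun j _ => if_neg (by have := j.2; omega)
    simp [this]
  | succ d ih =>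
    rw [ofReal_downloadTail_mul hN, answerEntropy_self hS']
    refine add_le_add_right ?_ _
    have hi := (ih ⟨i + 1, by omega⟩ (by simp only; omega)).trans
      (answerEntropy_le_mul hp hS i ⟨i + 1, by omega⟩ (i + 1))
    rw [pow_succ, ← mul_assoc, mul_comm _ (N : ℝ≥0∞)] at hi
    exact (ENNReal.mul_le_mul_iff_right (by simp; omega) (ENNReal.natCast_ne_top N)).mp hi

/-- The converse bound on the expected download. -/
theorem sum_div_pow_le_expectedDownload [Finite F] [Nontrivial F] (hN : 1 ≤ N)
    {S : RetrievalProtocol F N L} {p : Fin K → ℝ} (hp : ∀ i, 0 < p i) (hp1 : ∑ i, p i = 1)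
    (hS : S.IsPrivate p) (hS' : S.IsCorrect) :
    ENNReal.ofReal (∑ i : Fin K, (L i : ℝ) / (N : ℝ) ^ (i : ℕ)) ≤ S.expectedDownload p := by
  have := Fintype.ofFinite F
  rcases Nat.eq_zero_or_pos K with rfl | hK
  · simp
  have hlog : 0 < Real.log (Fintype.card F) :=
    Real.log_pos (by exact_mod_cast Fintype.one_lt_card)
  have h1 := downloadTail_le_answerEntropy hN hp hS hS' (K - 1) ⟨0, hK⟩ (by simp only; omega)
  have h2 : answerEntropy S ⟨0, hK⟩ 0 ≤
      S.expectedDownload p * ENNReal.ofReal (Real.log (Fintype.card F)) := by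
    rw [expectedDownload_eq hp hp1 hS ⟨0, hK⟩, ← ENNReal.tsum_mul_right]
    refine ENNReal.tsum_le_tsum fun q => ?_
    rw [mul_assoc]
    refine mul_le_mul_right ?_ _
    refine (ENNReal.ofReal_le_ofReal (condEntropy_le_log_card _ _)).trans_eq ?_
    -- The answers range over a set of size `|F|` to the total answer length.
    rw [Fintype.card_pi]
    simp only [Fintype.card_pi, Finset.prod_const, Finset.card_univ, Fintype.card_fin]
    rw [Finset.prod_pow_eq_pow_sum, Nat.cast_pow, Real.log_pow,
      ENNReal.ofReal_mul (Nat.cast_nonneg _), ENNReal.ofReal_natCast, Nat.cast_sum]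
  have h3 := h1.trans h2
  simp only [pow_zero, mul_one] at h3
  rw [ENNReal.ofReal_mul (downloadTail_nonneg _)] at h3
  have h4 := (ENNReal.mul_le_mul_iff_left (by simpa using hlog) ENNReal.ofReal_ne_top).mp h3
  simpa [downloadTail] using h4

end Converse

/-! ### Protocols that download sums of symbols. -/

section ItemProtocol

variable {F : Type*} [Field F] {N K ℓ : ℕ} {ι : Type} [Fintype ι]

open Classical in
/-- The number of symbols in the answer to the item `x`, which asks for the sums over `k` of the
symbols `x k` in the blocks of message `k`, where message `k` has `m k` blocks. -/
noncomputable def itemLength (m : Fin K → ℕ) (x : Fin K → Option (Fin ℓ)) : ℕ :=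
  (Finset.univ.filter fun k => x k ≠ none).sup m

/-- The sum over all messages of the symbols chosen by the item `x` in block `j`. -/
def itemSum {m : Fin K → ℕ} (x : Fin K → Option (Fin ℓ))
    (w : Messages F fun k => m k * ℓ) (j : ℕ) : F :=
  ∑ k, (x k).elim 0 fun s => if h : j < m k then w k (finProdFinEquiv (⟨j, h⟩, s)) else 0

lemma itemSum_of_itemLength_le {m : Fin K → ℕ} {x : Fin K → Option (Fin ℓ)} {j : ℕ}
    (h : itemLength m x ≤ j) (w : Messages F fun k => m k * ℓ) : itemSum x w j = 0 := by
  refine Finset.sum_eq_zero fun k _ => ?_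
  rcases hk : x k with _ | s
  · rfl
  · have : m k ≤ itemLength m x := by
      refine Finset.le_sup (f := m) ?_
      simp [hk]
    simp [show ¬ j < m k by omega]

lemma itemSum_update {m : Fin K → ℕ} {x : Fin K → Option (Fin ℓ)} {i : Fin K} (hx : x i = none)
    (s : Fin ℓ) (w : Messages F fun k => m k * ℓ) (j : Fin (m i)) :
    itemSum (Function.update x i (some s)) w j =
      itemSum x w j + w i (finProdFinEquiv (j, s)) := by
  have h : w i (finProdFinEquiv (j, s)) =
      ∑ k, if h : k = i then w k (finProdFinEquiv (⟨j, h ▸ j.2⟩, s)) else 0 := by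
    simp
  rw [h, itemSum, itemSum, ← Finset.sum_add_distrib]
  refine Finset.sum_congr rfl fun k _ => ?_
  by_cases hk : k = i
  · subst hk
    simp [hx]
  · simp [hk]

/-- The protocol in which each query is a family of items, all of which are answered. -/
noncomputable def itemProtocol (F : Type*) [Field F] (m : Fin K → ℕ)
    (law : Fin K → PMF (Fin N → ι → Fin K → Option (Fin ℓ))) :
    RetrievalProtocol F N (fun k => m k * ℓ) where
  Query := ι → Fin K → Option (Fin ℓ)
  queryLaw := law
  answerLength _ q := ∑ x, itemLength m (q x)
  answer _ q w t :=
    let y := (Fintype.equivFinOfCardEq (α := Σ x : ι, Fin (itemLength m (q x)))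
      (n := ∑ x, itemLength m (q x)) (by simp)).symm t
    itemSum (q y.1) w y.2

lemma itemSum_eq_of_answer_eq {m : Fin K → ℕ}
    {law : Fin K → PMF (Fin N → ι → Fin K → Option (Fin ℓ))} {n : Fin N}
    {q : ι → Fin K → Option (Fin ℓ)} {w w' : Messages F fun k => m k * ℓ}
    (h : (itemProtocol F m law).answer n q w = (itemProtocol F m law).answer n q w')
    (x : ι) (j : ℕ) : itemSum (q x) w j = itemSum (q x) w' j := by
  by_cases hj : j < itemLength m (q x)
  · have := congrFun h ((Fintype.equivFinOfCardEq (α := Σ x : ι, Fin (itemLength m (q x)))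
      (n := ∑ x, itemLength m (q x)) (by simp)) ⟨x, ⟨j, hj⟩⟩)
    simp only [itemProtocol] at this
    rwa [Equiv.symm_apply_apply] at this
  · rw [itemSum_of_itemLength_le (not_lt.mp hj), itemSum_of_itemLength_le (not_lt.mp hj)]

/-- Symbol `s` of message `i`, in all blocks at once, is the difference of two answered items that
differ only by it. -/
lemma itemProtocol_isCorrect {m : Fin K → ℕ}
    {law : Fin K → PMF (Fin N → ι → Fin K → Option (Fin ℓ))}
    (h : ∀ i, ∀ q ∈ (law i).support, ∀ s, ∃ n x n' x', q n' x' i = none ∧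
      q n x = Function.update (q n' x') i (some s)) :
    (itemProtocol F m law).IsCorrect := by
  intro i q hq w w' hw
  funext t
  obtain ⟨⟨j, s⟩, rfl⟩ := finProdFinEquiv.surjective t
  obtain ⟨n, x, n', x', hnone, hupd⟩ := h i q hq s
  have h1 := itemSum_eq_of_answer_eq (hw n) x j
  have h2 := itemSum_eq_of_answer_eq (hw n') x' j
  rw [hupd, itemSum_update hnone, itemSum_update hnone, h2] at h1
  exact add_left_cancel h1

/-- The item `x` involves message `k` and no message before `k`. -/
def IsLeading {α : Type*} (x : Fin K → Option α) (k : Fin K) : Prop :=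
  x k ≠ none ∧ ∀ j < k, x j = none

-- Block counts decrease with the index, so the first message involved is the longest one. This
-- makes the download depend on leading messages only.
open Classical in
lemma itemLength_le {m : Fin K → ℕ} (hm : Antitone m) (x : Fin K → Option (Fin ℓ)) :
    itemLength m x ≤ ∑ k, if IsLeading x k then m k else 0 := by
  refine Finset.sup_le fun k hk => ?_
  have hne : (Finset.univ.filter fun k => x k ≠ none).Nonempty := ⟨k, hk⟩
  set k₀ := (Finset.univ.filter fun k => x k ≠ none).min' hne with hk₀
  have hmem := Finset.min'_mem _ hne
  rw [← hk₀] at hmem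
  have hlead : IsLeading x k₀ := by
    refine ⟨by simpa using hmem, fun j hj => ?_⟩
    by_contra hne'
    exact absurd (Finset.min'_le _ j (by simpa using hne')) (not_le.mpr hj)
  calc m k ≤ m k₀ := hm (Finset.min'_le _ _ hk)
    _ = if IsLeading x k₀ then m k₀ else 0 := by rw [if_pos hlead]
    _ ≤ _ := Finset.single_le_sum (f := fun k => if IsLeading x k then m k else 0)
      (fun _ _ => Nat.zero_le _) (Finset.mem_univ k₀)

lemma tsum_uniformOfFintype_mul {Ω : Type*} [Fintype Ω] [Nonempty Ω] (f : Ω → ℕ) :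
    ∑' ω, PMF.uniformOfFintype Ω ω * (f ω : ℝ≥0∞) =
      ENNReal.ofReal ((∑ ω, (f ω : ℝ)) / Fintype.card Ω) := by
  have hΩ : (0 : ℝ) < Fintype.card Ω := by exact_mod_cast Fintype.card_pos
  rw [tsum_fintype, ENNReal.ofReal_div_of_pos hΩ,
    ENNReal.ofReal_sum_of_nonneg fun _ _ => Nat.cast_nonneg _]
  simp only [PMF.uniformOfFintype_apply, ENNReal.ofReal_natCast]
  rw [← Finset.mul_sum, mul_comm, div_eq_mul_inv]

open Classical in
/-- Lower bound on the capacity from a family of item queries `Q i ω`, with `ω` uniform, such that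
each database receives items distributed as `R n ω` whichever message is desired. -/
theorem le_exactSizeCapacity_of_items {Ω : Type} [Fintype Ω] [Nonempty Ω] (hN : 1 ≤ N)
    {p : Fin K → ℝ} (hp : ∀ i, 0 < p i) (hp1 : ∑ i, p i = 1) {m : Fin K → ℕ} (hm : Antitone m)
    (Q : Fin K → Ω → Fin N → ι → Fin K → Option (Fin ℓ))
    (R : Fin N → Ω → ι → Fin K → Option (Fin ℓ))
    (hQ : ∀ i n, ∃ τ : Equiv.Perm Ω, ∀ ω, Q i ω n = R n (τ ω))
    (hdec : ∀ i ω s, ∃ n x n' x', Q i ω n' x' i = none ∧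
      Q i ω n x = Function.update (Q i ω n' x') i (some s))
    (hcost : ∀ k : Fin K, N ^ (k : ℕ) *
      ∑ n, ∑ ω, (Finset.univ.filter fun x => IsLeading (R n ω x) k).card = ℓ * Fintype.card Ω) :
    ENNReal.ofReal (expectedSize p fun k => m k * ℓ) /
        ENNReal.ofReal (∑ i : Fin K, ((m i * ℓ : ℕ) : ℝ) / (N : ℝ) ^ (i : ℕ)) ≤
      exactSizeCapacity F N p (fun k => m k * ℓ) := by
  have hN0 : (0 : ℝ) < N := by exact_mod_cast hN
  have hΩ : (0 : ℝ) < Fintype.card Ω := by exact_mod_cast Fintype.card_pos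
  set S : RetrievalProtocol F N (fun k => m k * ℓ) :=
    itemProtocol F m fun i => (PMF.uniformOfFintype Ω).map (Q i) with hS
  have hcorrect : S.IsCorrect := by
    refine itemProtocol_isCorrect fun i q hq s => ?_
    obtain ⟨ω, -, rfl⟩ := (PMF.mem_support_map_iff _ _ _).mp hq
    exact hdec i ω s
  have hlaw : ∀ i n, S.databaseLaw i n = (PMF.uniformOfFintype Ω).map (R n) := by
    intro i n
    obtain ⟨τ, hτ⟩ := hQ i n
    -- The permutation `τ` of the randomness preserves the uniform law, so the dependence on `i`
    -- disappears.
    have h1 : S.databaseLaw i n = ((PMF.uniformOfFintype Ω).map τ).map (R n) := by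
      have h2 : S.databaseLaw i n = ((PMF.uniformOfFintype Ω).map (Q i)).map
        fun q : Fin N → ι → Fin K → Option (Fin ℓ) => q n := rfl
      rw [h2, PMF.map_comp, PMF.map_comp]
      congr 1
      funext ω
      exact hτ ω
    have h2 : (PMF.uniformOfFintype Ω).map τ = PMF.uniformOfFintype Ω := by
      ext ω
      rw [PMF.map_apply, tsum_eq_single (τ.symm ω)]
      · simp
      · intro ω' h
        rw [if_neg]
        rintro rfl
        simp at h
    rw [h1, h2]
  have hpriv : S.IsPrivate p :=
    isPrivate_of_databaseLaw_eq hp1 fun i j n => by rw [hlaw, hlaw]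
  have hD : S.expectedDownload p ≤
      ENNReal.ofReal (∑ i : Fin K, ((m i * ℓ : ℕ) : ℝ) / (N : ℝ) ^ (i : ℕ)) := by
    rcases Nat.eq_zero_or_pos K with rfl | hK
    · simp at hp1
    have h0 : S.expectedDownload p = ∑ n, ∑' ω, PMF.uniformOfFintype Ω ω *
        ((∑ x, itemLength m (R n ω x) : ℕ) : ℝ≥0∞) := by
      rw [expectedDownload_eq hp hp1 hpriv ⟨0, hK⟩, tsum_mul_finset_sum]
      refine Finset.sum_congr rfl fun n _ => ?_
      rw [← tsum_pmf_map_mul (S.queryLaw ⟨0, hK⟩) (fun q => q n)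
        (fun y => (S.answerLength n y : ℝ≥0∞))]
      change ∑' b, S.databaseLaw ⟨0, hK⟩ n b * (S.answerLength n b : ℝ≥0∞) = _
      rw [hlaw]
      exact tsum_pmf_map_mul (PMF.uniformOfFintype Ω) (R n)
        fun y => ((∑ x, itemLength m (y x) : ℕ) : ℝ≥0∞)
    rw [h0]
    simp only [tsum_uniformOfFintype_mul]
    rw [← ENNReal.ofReal_sum_of_nonneg fun _ _ =>
      div_nonneg (Finset.sum_nonneg fun _ _ => Nat.cast_nonneg _) hΩ.le]
    refine ENNReal.ofReal_le_ofReal ?_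
    rw [← Finset.sum_div, div_le_iff₀ hΩ]
    calc ∑ n : Fin N, ∑ ω : Ω, ((∑ x, itemLength m (R n ω x) : ℕ) : ℝ)
        ≤ ∑ n : Fin N, ∑ ω : Ω,
            ((∑ x, ∑ k, if IsLeading (R n ω x) k then m k else 0 : ℕ) : ℝ) := by
          refine Finset.sum_le_sum fun n _ => Finset.sum_le_sum fun ω _ => ?_
          exact_mod_cast Finset.sum_le_sum fun x _ => itemLength_le hm _
      _ = ∑ k, (m k : ℝ) * ((∑ n, ∑ ω,
            (Finset.univ.filter fun x => IsLeading (R n ω x) k).card : ℕ) : ℝ) := by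
          norm_cast
          simp only [Finset.mul_sum]
          symm
          rw [Finset.sum_comm]
          refine Finset.sum_congr rfl fun n _ => ?_
          rw [Finset.sum_comm]
          refine Finset.sum_congr rfl fun ω _ => ?_
          rw [Finset.sum_comm]
          refine Finset.sum_congr rfl fun k _ => ?_
          rw [Finset.card_filter, Finset.mul_sum]
          simp
      _ = (∑ i : Fin K, ((m i * ℓ : ℕ) : ℝ) / (N : ℝ) ^ (i : ℕ)) * Fintype.card Ω := by
          rw [Finset.sum_mul]
          refine Finset.sum_congr rfl fun k _ => ?_
          have := congrArg (Nat.cast (R := ℝ)) (hcost k)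
          rw [Nat.cast_mul, Nat.cast_mul, Nat.cast_pow] at this
          rw [Nat.cast_mul, div_mul_eq_mul_div, eq_div_iff (by positivity)]
          linear_combination (m k : ℝ) * this
  refine le_trans (ENNReal.div_le_div_left hD _) ?_
  exact le_iSup_of_le S (le_iSup_of_le hcorrect (le_iSup_of_le hpriv (by simp)))

end ItemProtocol

/-! ### The cyclic scheme, for sizes divisible by N - 1. -/

section CyclicScheme

variable {K r : ℕ}

lemma pow_mul_prod_ite_lt (a : ℕ) (k : Fin K) (f : Fin K → ℕ) :
    a ^ (k : ℕ) * ∏ j, f j = ∏ j : Fin K, ((if j < k then a else 1) * f j) := by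
  rw [Finset.prod_mul_distrib]
  congr 1
  rw [Finset.prod_ite, Finset.prod_const, Finset.prod_const_one, mul_one]
  congr 1
  rw [Finset.filter_gt_eq_Iio, Fin.card_Iio]

/-- The vectors form a box: one choice before `k`, `r` choices at `k`, and `r + 1` after it. The
prefactors are absorbed coordinate by coordinate, which avoids subtraction in exponents. -/
lemma card_leading_vectors (k : Fin K) :
    (r + 1) ^ (k : ℕ) * ((r + 1) *
      (Finset.univ.filter fun v : Fin K → Fin (r + 1) => v k ≠ 0 ∧ ∀ j < k, v j = 0).card) =
        r * (r + 1) ^ K := by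
  have : (Finset.univ.filter fun v : Fin K → Fin (r + 1) => v k ≠ 0 ∧ ∀ j < k, v j = 0) =
      Fintype.piFinset fun j => if j < k then {0} else if j = k then {0}ᶜ else Finset.univ := by
    ext v
    simp only [Finset.mem_filter, Finset.mem_univ, true_and, Fintype.mem_piFinset]
    refine ⟨fun h j => ?_, fun h => ⟨?_, fun j hj => ?_⟩⟩
    · split_ifs with h1 h2
      · simpa using h.2 j h1
      · subst h2; simpa using h.1
      · simp
    · simpa using h k
    · simpa [hj] using h j
  rw [this, Fintype.card_piFinset]
  have h1 : (r + 1) = ∏ j : Fin K, if j = k then r + 1 else 1 := by simp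
  have h2 : r * (r + 1) ^ K = ∏ j : Fin K, (if j = k then r else 1) * (r + 1) := by
    rw [Finset.prod_mul_distrib]; simp
  rw [h2]
  conv_lhs => rw [mul_comm (r + 1), ← mul_assoc]; arg 2; rw [h1]
  rw [pow_mul_prod_ite_lt, ← Finset.prod_mul_distrib]
  refine Finset.prod_congr rfl fun j _ => ?_
  by_cases h1 : j < k
  · simp [h1, h1.ne]
  · by_cases h2 : j = k
    · simp [h2, Finset.card_compl]
    · simp [h1, h2]

/-- A capacity-achieving protocol for message sizes that are multiples of `N - 1`: a random vector
of cyclic positions, shifted by the database index in the desired coordinate. -/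
theorem le_exactSizeCapacity_of_dvd_sub_one {F : Type*} [Field F] {p : Fin K → ℝ}
    (hp : ∀ i, 0 < p i) (hp1 : ∑ i, p i = 1) {m : Fin K → ℕ} (hm : Antitone m) :
    ENNReal.ofReal (expectedSize p fun k => m k * r) /
        ENNReal.ofReal (∑ i : Fin K, ((m i * r : ℕ) : ℝ) / ((r + 1 : ℕ) : ℝ) ^ (i : ℕ)) ≤
      exactSizeCapacity F (r + 1) p (fun k => m k * r) := by
  classical
  refine le_exactSizeCapacity_of_items (Ω := Fin K → Fin (r + 1)) (ι := Unit) (by omega) hp hp1 hm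
    (fun i v n _ k => finSuccEquiv r (v k + (Pi.single i n : Fin K → Fin (r + 1)) k)) (fun _ v _ k => finSuccEquiv r (v k))
    (fun i n => ⟨Equiv.addRight (Pi.single i n), fun v => rfl⟩) (fun i v s => ?_) (fun k => ?_)
  -- Database `n` sees `v i + n` at the desired coordinate. Value 0 means no symbol, so database `-v
  -- i` returns the bare interference, and database `s.succ - v i` adds symbol `s` to it.
  · refine ⟨s.succ - v i, (), - v i, (), by simp, ?_⟩
    funext k
    by_cases h : k = i
    · subst h; simp
    · simp [h]
  · have h0 : ∀ v : Fin K → Fin (r + 1),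
        IsLeading (fun k => finSuccEquiv r (v k)) k ↔ v k ≠ 0 ∧ ∀ j < k, v j = 0 := by
      intro v
      have h : ∀ a : Fin (r + 1), finSuccEquiv r a = none ↔ a = 0 := fun a => by
        rw [← finSuccEquiv_zero, Equiv.apply_eq_iff_eq]
      simp [IsLeading, h]
    have h1 : ∑ v : Fin K → Fin (r + 1), (Finset.univ.filter fun _ : Unit =>
        IsLeading (fun k => finSuccEquiv r (v k)) k).card =
        (Finset.univ.filter fun v : Fin K → Fin (r + 1) => v k ≠ 0 ∧ ∀ j < k, v j = 0).card := by
      rw [Finset.card_filter]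
      refine Finset.sum_congr rfl fun v _ => ?_
      rw [Finset.card_filter]
      simp [h0]
    simp only [h1, Finset.sum_const, Finset.card_univ, Fintype.card_fin, smul_eq_mul,
      Fintype.card_fun]
    exact card_leading_vectors k

end CyclicScheme

/-! ### The scheme of normalized vectors, for sizes divisible by N^(K-1). -/

section ProjectiveScheme

variable {K r : ℕ}

/-- An item `(t, v)` stands for the vector with first nonzero coordinate `1` at position `t` and
with the coordinates of `v` after it. -/
abbrev Item (K r : ℕ) : Type := Fin K × (Fin K → Fin (r + 1))

/-- The vector `v` of the item `(t, v)` vanishes up to position `t`. -/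
def Item.IsValid (x : Item K r) : Prop := ∀ j ≤ x.1, x.2 j = 0

/-- The valid item `x` asks for a symbol of message `k`. -/
def Item.Involves (x : Item K r) (k : Fin K) : Prop := x.IsValid ∧ (k = x.1 ∨ x.2 k ≠ 0)

/-- The database that receives the item. -/
def Item.database (x : Item K r) : Fin (r + 1) := ∑ j, x.2 j

open Classical in
/-- The item asking for the same interference as `x` without a symbol of message `i`; the item that
involves `i` alone is left as it is. -/
noncomputable def Item.forget (i : Fin K) (x : Item K r) : Item K r :=
  if x.1 = i then
    if h : ∃ t, x.2 t ≠ 0 ∧ ∀ j < t, x.2 j = 0 then (h.choose, Function.update x.2 h.choose 0)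
    else x
  else (x.1, Function.update x.2 i 0)

open Classical in
/-- The item in database `n` with the same interference as `x`, for the desired message `i`. -/
noncomputable def Item.complete (i : Fin K) (n : Fin (r + 1)) (x : Item K r) : Item K r :=
  if n = x.database then x
  else if x.1 < i then (x.1, Function.update x.2 i (n - x.database))
  else (i, Function.update x.2 x.1 (n - x.database))

lemma exists_leading_coordinate {v : Fin K → Fin (r + 1)} (hv : v ≠ 0) :
    ∃ t, v t ≠ 0 ∧ ∀ j < t, v j = 0 := by
  classical
  have hne : (Finset.univ.filter fun t => v t ≠ 0).Nonempty := by
    obtain ⟨t, ht⟩ := Function.ne_iff.mp hv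
    exact ⟨t, by simpa using ht⟩
  refine ⟨_, by simpa using Finset.min'_mem _ hne, fun j hj => ?_⟩
  by_contra h
  exact absurd (Finset.min'_le _ j (by simpa using h)) (not_le.mpr hj)

lemma sum_update_zero_add (v : Fin K → Fin (r + 1)) (t : Fin K) :
    ∑ j, Function.update v t 0 j + v t = ∑ j, v j := by
  have h : ∀ j, v j = Function.update v t 0 j + (Pi.single t (v t) : Fin K → Fin (r + 1)) j := by
    intro j
    by_cases hj : j = t
    · subst hj; simp
    · simp [hj]
  rw [Finset.sum_congr rfl fun j _ => h j, Finset.sum_add_distrib]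
  simp

namespace Item

/-- The possible effects of forgetting message `i` in a valid item. -/
lemma forget_cases {x : Item K r} (hx : x.IsValid) (i : Fin K) :
    (¬ x.Involves i ∧ x.forget i = x) ∨ (x = (i, 0) ∧ x.forget i = x) ∨
    (x.1 < i ∧ x.2 i ≠ 0 ∧ x.forget i = (x.1, Function.update x.2 i 0)) ∨
    (x.1 = i ∧ ∃ t, i < t ∧ x.2 t ≠ 0 ∧ (∀ j < t, x.2 j = 0) ∧
      x.forget i = (t, Function.update x.2 t 0)) := by
  by_cases hi : x.1 = i
  · by_cases hv : x.2 = 0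
    · refine Or.inr (Or.inl ⟨Prod.ext hi hv, ?_⟩)
      simp only [forget, hv, Pi.zero_apply, ne_eq, not_true_eq_false, false_and, exists_false,
        dif_neg, not_false_eq_true, if_pos hi]
    · have h := exists_leading_coordinate hv
      refine Or.inr (Or.inr (Or.inr ⟨hi, h.choose, ?_, h.choose_spec.1, h.choose_spec.2, ?_⟩))
      · by_contra hle
        exact h.choose_spec.1 (hx _ (by rw [hi]; exact not_lt.mp hle))
      · rw [forget, if_pos hi, dif_pos h]
  · by_cases hv : x.2 i = 0
    · refine Or.inl ⟨fun h => h.2.elim (fun h => hi h.symm) fun h => h hv, ?_⟩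
      rw [forget, if_neg hi]
      exact Prod.ext rfl (Function.update_eq_self_iff.mpr hv.symm)
    · refine Or.inr (Or.inr (Or.inl ⟨?_, hv, by rw [forget, if_neg hi]⟩))
      by_contra hle
      exact hv (hx _ (not_lt.mp hle))

lemma forget_isValid {x : Item K r} (hx : x.IsValid) (i : Fin K) : (x.forget i).IsValid := by
  rcases forget_cases hx i with ⟨-, h⟩ | ⟨-, h⟩ | ⟨hi, -, h⟩ | ⟨-, t, hit, -, ht, h⟩
  · rwa [h]
  · rwa [h]
  · rw [h]
    intro j hj
    simp only at hj ⊢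
    rw [Function.update_of_ne (hj.trans_lt hi).ne]
    exact hx j hj
  · rw [h]
    intro j hj
    simp only at hj ⊢
    rcases hj.eq_or_lt with rfl | hj
    · simp
    · rw [Function.update_of_ne hj.ne]
      exact ht j hj

lemma forget_involves_iff {x : Item K r} (hx : x.IsValid) {i k : Fin K} (hk : k ≠ i) :
    (x.forget i).Involves k ↔ x.Involves k := by
  have hv := forget_isValid hx i
  simp only [Involves, hx, hv, true_and]
  rcases forget_cases hx i with ⟨-, h⟩ | ⟨-, h⟩ | ⟨hi, -, h⟩ | ⟨hi, t, hit, hxt, ht, h⟩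
  · rw [h]
  · rw [h]
  · rw [h]
    simp [Function.update_of_ne hk]
  · rw [h]
    by_cases hkt : k = t
    · subst hkt; simp [hxt]
    · simp [hkt, hi, hk]

lemma not_forget_involves {x : Item K r} (hx : x.IsValid) {i : Fin K} (hne : x ≠ (i, 0)) :
    ¬ (x.forget i).Involves i := by
  rcases forget_cases hx i with ⟨hi, h⟩ | ⟨h, -⟩ | ⟨hi, -, h⟩ | ⟨hi, t, hit, hxt, ht, h⟩
  · rwa [h]
  · exact absurd h hne
  · rw [h]
    rintro ⟨-, h | h⟩
    · exact hi.ne' h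
    · simp at h
  · rw [h]
    rintro ⟨-, h | h⟩
    · exact hit.ne h
    · simp only [Function.update_of_ne hit.ne] at h
      exact h (ht i hit)

lemma forget_of_not_involves {x : Item K r} (hx : x.IsValid) {i : Fin K} (h : ¬ x.Involves i) :
    x.forget i = x := by
  rcases forget_cases hx i with ⟨-, h'⟩ | ⟨-, h'⟩ | ⟨-, hi, -⟩ | ⟨hi, -⟩
  · exact h'
  · exact h'
  · exact absurd ⟨hx, Or.inr hi⟩ h
  · exact absurd ⟨hx, Or.inl hi.symm⟩ h

/-- Forgetting erases one coordinate of `v`; since the database is the sum of the coordinates, the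
erased value is recovered by subtraction. -/
lemma complete_forget {x : Item K r} (hx : x.IsValid) (i : Fin K) :
    (x.forget i).complete i x.database = x := by
  rcases forget_cases hx i with ⟨-, h⟩ | ⟨-, h⟩ | ⟨hi, hxi, h⟩ | ⟨hi, t, hit, hxt, ht, h⟩
  · rw [h, complete, if_pos rfl]
  · rw [h, complete, if_pos rfl]
  · have hs : x.database = (x.forget i).database + x.2 i := by
      rw [h]; exact (sum_update_zero_add x.2 i).symm
    rw [complete, if_neg (by rw [hs]; simpa using hxi), hs, add_sub_cancel_left, h, if_pos hi]
    simp
  · have hs : x.database = (x.forget i).database + x.2 t := by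
      rw [h]; exact (sum_update_zero_add x.2 t).symm
    rw [complete, if_neg (by rw [hs]; simpa using hxt), hs, add_sub_cancel_left, h,
      if_neg (not_lt.mpr hit.le)]
    simp [← hi]

/-- Forgetting the desired message is injective on the items of each database. -/
lemma forget_inj {x y : Item K r} (hx : x.IsValid) (hy : y.IsValid) {i : Fin K}
    (hxy : x.database = y.database) (h : x.forget i = y.forget i) : x = y := by
  rw [← complete_forget hx i, ← complete_forget hy i, h, hxy]

end Item

lemma card_vanishing (s : Finset (Fin K)) :
    (Finset.univ.filter fun v : Fin K → Fin (r + 1) => ∀ j ∈ s, v j = 0).card =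
      (r + 1) ^ (K - s.card) := by
  have : (Finset.univ.filter fun v : Fin K → Fin (r + 1) => ∀ j ∈ s, v j = 0) =
      Fintype.piFinset fun j => if j ∈ s then {0} else Finset.univ := by
    ext v
    simp only [Finset.mem_filter, Finset.mem_univ, true_and, Fintype.mem_piFinset]
    refine forall_congr' fun j => ?_
    split_ifs with h <;> simp [h]
  rw [this, Fintype.card_piFinset]
  have h : ∀ j : Fin K, (if j ∈ s then ({0} : Finset (Fin (r + 1))) else Finset.univ).card =
      if j ∈ s then 1 else r + 1 := fun j => by split_ifs <;> simp
  simp only [h]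
  rw [Finset.prod_ite, Finset.prod_const_one, one_mul, Finset.prod_const, ← Finset.compl_filter,
    Finset.card_compl]
  simp

open Classical in
lemma card_isValid (k : Fin K) :
    (Finset.univ.filter fun v : Fin K → Fin (r + 1) => Item.IsValid (k, v)).card =
      (r + 1) ^ (K - (k + 1)) := by
  classical
  have h := card_vanishing (r := r) (Finset.Iic k)
  rw [Fin.card_Iic] at h
  rw [← h]
  refine congrArg Finset.card (Finset.ext fun v => ?_)
  rw [Finset.mem_filter, Finset.mem_filter]
  simp [Item.IsValid]

-- When `t < k`, the valid items led by `t` that avoid `k` have one more coordinate forced to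
-- vanish. The count has the form of a difference that telescopes over `t`.
open Classical in
lemma card_involves_fst (t k : Fin K) :
    (Finset.univ.filter fun v : Fin K → Fin (r + 1) => Item.Involves (t, v) k).card +
        (if (t : ℕ) + 1 ≤ k then (r + 1) ^ (K - (t + 1 + 1)) else 0) =
      if (t : ℕ) ≤ k then (r + 1) ^ (K - (t + 1)) else 0 := by
  rcases lt_trichotomy t k with h | rfl | h
  · have h' : (t : ℕ) < k := h
    rw [if_pos (Nat.succ_le_of_lt h'), if_pos h'.le, ← card_isValid,
      ← Finset.card_filter_add_card_filter_not
        (s := Finset.univ.filter fun v : Fin K → Fin (r + 1) => Item.IsValid (t, v))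
        fun v => v k ≠ 0, Finset.filter_filter, Finset.filter_filter]
    congr 1
    · refine congrArg Finset.card (Finset.ext fun v => ?_)
      simp [Item.Involves, h.ne']
    · have h2 := card_vanishing (r := r) (insert k (Finset.Iic t))
      rw [Finset.card_insert_of_notMem (by simpa using h), Fin.card_Iic] at h2
      rw [← h2]
      refine congrArg Finset.card (Finset.ext fun v => ?_)
      simp [Item.IsValid, and_comm]
  · rw [if_neg (by omega), if_pos le_rfl, add_zero, ← card_isValid]
    refine congrArg Finset.card (Finset.ext fun v => ?_)
    simp [Item.Involves]
  · have h' : (k : ℕ) < t := h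
    rw [if_neg (by omega), if_neg (by omega), add_zero, Finset.card_eq_zero,
      Finset.filter_eq_empty_iff]
    rintro v - ⟨hv, hk | hk⟩
    · exact h.ne hk
    · exact hk (hv k h.le)

open Classical in
lemma card_involves (k : Fin K) :
    Fintype.card {x : Item K r // x.Involves k} = (r + 1) ^ (K - 1) := by
  have hK : 0 < K := k.pos
  set g : ℕ → ℤ := fun s => if s ≤ k then ((r : ℤ) + 1) ^ (K - (s + 1)) else 0 with hg
  have h : ∀ t : Fin K,
      ((Finset.univ.filter fun v : Fin K → Fin (r + 1) => Item.Involves (t, v) k).card : ℤ) =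
        g t - g (t + 1) := by
    intro t
    have := congrArg (Nat.cast (R := ℤ)) (card_involves_fst (r := r) t k)
    push_cast at this
    simp only [hg]
    linarith
  zify
  rw [Fintype.card_subtype, Finset.card_filter, Fintype.sum_prod_type]
  simp only [← Finset.card_filter]
  push_cast
  simp only [h]
  rw [Fin.sum_univ_eq_sum_range (fun t => g t - g (t + 1)), Finset.sum_range_sub']
  simp [hg]

/-- For the desired message `i`, the symbol of message `k` used in the item `x`. -/
noncomputable def itemSymbol (i k : Fin K) (x : {x : Item K r // x.Involves k}) :
    {x : Item K r // x.Involves k} :=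
  if h : k = i then x
  else ⟨x.1.forget i, (Item.forget_involves_iff x.2.1 h).mpr x.2⟩

/-- This is the source of privacy. Within one database the reused symbols are still distinct, by
`Item.forget_inj`, so the assignment extends to a permutation, which a uniformly random labelling of
the symbols absorbs. -/
lemma exists_perm_itemSymbol (i k : Fin K) (n : Fin (r + 1)) :
    ∃ τ : Equiv.Perm {x : Item K r // x.Involves k}, ∀ x, x.1.database = n →
      τ x = itemSymbol i k x := by
  classical
  obtain ⟨g, hg⟩ := Finset.exists_equiv_extend_of_card_eq (t := Finset.univ)
    (s := Finset.univ.filter fun x : {x : Item K r // x.Involves k} => x.1.database = n)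
    (f := itemSymbol i k) (by simp) (by simp) (by
      intro x hx y hy hxy
      simp only [Finset.coe_filter, Finset.mem_univ, true_and, Set.mem_ofPred_eq] at hx hy
      unfold itemSymbol at hxy
      split_ifs at hxy with h
      · exact hxy
      · exact Subtype.ext (Item.forget_inj x.2.1 y.2.1 (hx.trans hy.symm) (Subtype.ext_iff.mp hxy)))
  exact ⟨g.trans (Equiv.subtypeUnivEquiv fun x => Finset.mem_univ x), fun x hx =>
    hg x (by simpa using hx)⟩

open Classical in
/-- The query to database `n` in which the items are sent with the symbols given by `f`. -/
noncomputable def itemQuery {ℓ : ℕ} (n : Fin (r + 1))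
    (f : (k : Fin K) → {x : Item K r // x.Involves k} → Fin ℓ) (y : Option (Item K r))
    (k : Fin K) : Option (Fin ℓ) :=
  y.elim none fun x =>
    if h : x.database = n ∧ x.Involves k then some (f k ⟨x, h.2⟩) else none

lemma isLeading_itemQuery {ℓ : ℕ} {n : Fin (r + 1)}
    {f : (k : Fin K) → {x : Item K r // x.Involves k} → Fin ℓ} {x : Item K r} {k : Fin K} :
    IsLeading (itemQuery n f (some x)) k ↔ x.database = n ∧ x.IsValid ∧ x.1 = k := by
  have h : ∀ k, itemQuery n f (some x) k = none ↔ ¬ (x.database = n ∧ x.Involves k) := by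
    intro k
    simp only [itemQuery, Option.elim_some]
    split_ifs with h <;> simp [h]
  simp only [IsLeading, ne_eq, h, not_not]
  constructor
  · rintro ⟨⟨hn, hv, hk⟩, hlt⟩
    refine ⟨hn, hv, ?_⟩
    have h1 : ¬ x.1 < k := fun h => hlt _ h ⟨hn, hv, Or.inl rfl⟩
    rcases hk with hk | hk
    · exact hk.symm
    · exact absurd (hv k (not_lt.mp h1)) hk
  · rintro ⟨hn, hv, rfl⟩
    refine ⟨⟨hn, hv, Or.inl rfl⟩, fun j hj h => ?_⟩
    rcases h.2.2 with h | h
    · exact hj.ne h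
    · exact h (hv j hj.le)

/-- A capacity-achieving protocol for message sizes that are multiples of `N ^ (K - 1)`. -/
theorem le_exactSizeCapacity_of_dvd_pow {F : Type*} [Field F] {p : Fin K → ℝ}
    (hp : ∀ i, 0 < p i) (hp1 : ∑ i, p i = 1) {m : Fin K → ℕ} (hm : Antitone m) :
    ENNReal.ofReal (expectedSize p fun k => m k * (r + 1) ^ (K - 1)) /
        ENNReal.ofReal (∑ i : Fin K,
          ((m i * (r + 1) ^ (K - 1) : ℕ) : ℝ) / ((r + 1 : ℕ) : ℝ) ^ (i : ℕ)) ≤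
      exactSizeCapacity F (r + 1) p (fun k => m k * (r + 1) ^ (K - 1)) := by
  classical
  set ℓ := (r + 1) ^ (K - 1) with hℓ
  have hne : Nonempty ((k : Fin K) → ({x : Item K r // x.Involves k} ≃ Fin ℓ)) :=
    ⟨fun k => Fintype.equivFinOfCardEq (card_involves k)⟩
  refine le_exactSizeCapacity_of_items
    (Ω := (k : Fin K) → ({x : Item K r // x.Involves k} ≃ Fin ℓ)) (ι := Option (Item K r))
    (by omega) hp hp1 hm
    (fun i π n => itemQuery n fun k x => π k (itemSymbol i k x))
    (fun n π => itemQuery n fun k x => π k x) (fun i n => ?_) (fun i π s => ?_) (fun k => ?_)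
  · choose τ hτ using fun k => exists_perm_itemSymbol (K := K) (r := r) i k n
    -- The permutation of the randomness is `π k ↦ π k ∘ τ k`, independently for each message.
    refine ⟨Equiv.piCongrRight fun k => Equiv.equivCongr (τ k).symm (Equiv.refl _), fun π => ?_⟩
    funext y k
    rcases y with _ | x
    · rfl
    · simp only [itemQuery, Option.elim_some]
      split_ifs with h
      · simp [hτ k ⟨x, h.2⟩ h.1]
      · rfl
  · set x := (π i).symm s with hx
    have hs : π i (itemSymbol i i x) = s := by simp [itemSymbol, hx]
    by_cases h0 : x.1 = (i, 0)
    · refine ⟨x.1.database, some x.1, 0, none, rfl, ?_⟩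
      funext k
      by_cases hk : k = i
      · subst hk
        simp only [itemQuery, Option.elim_some, Function.update_self]
        rw [dif_pos ⟨trivial, x.2⟩, hs]
      · have : ¬ x.1.Involves k := by
          rw [h0]
          rintro ⟨-, h | h⟩
          · exact hk h
          · simp at h
        simp [itemQuery, hk, this]
    · have hnot := Item.not_forget_involves x.2.1 h0
      have hval := Item.forget_isValid x.2.1 i
      refine ⟨x.1.database, some x.1, (x.1.forget i).database, some (x.1.forget i), ?_, ?_⟩
      · simp [itemQuery, hnot]
      funext k
      by_cases hk : k = i
      · subst hk
        simp only [itemQuery, Option.elim_some, Function.update_self]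
        rw [dif_pos ⟨trivial, x.2⟩, hs]
      · rw [Function.update_of_ne hk]
        simp only [itemQuery, Option.elim_some, true_and, Item.forget_involves_iff x.2.1 hk]
        split_ifs with h
        -- Forgetting twice changes nothing, so both items carry the same symbol of message `k`.
        · simp only [itemSymbol, dif_neg hk, Item.forget_of_not_involves hval hnot]
        · rfl
  · have h1 : ∀ (n : Fin (r + 1)) (π : (k : Fin K) → ({x : Item K r // x.Involves k} ≃ Fin ℓ)),
        (Finset.univ.filter fun y => IsLeading (itemQuery n (fun k x => π k x) y) k).card =
          ∑ v : Fin K → Fin (r + 1),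
            if Item.IsValid (k, v) then (if Item.database (k, v) = n then 1 else 0) else 0 := by
      intro n π
      rw [Finset.card_filter, Fintype.sum_option]
      simp only [isLeading_itemQuery]
      rw [if_neg (by simp [IsLeading, itemQuery]), zero_add, Fintype.sum_prod_type,
        Finset.sum_eq_single k]
      · refine Finset.sum_congr rfl fun v _ => ?_
        by_cases h : Item.IsValid (k, v) <;> simp [h]
      · intro t _ ht
        simp [ht]
      · simp
    simp only [h1, Finset.sum_const, Finset.card_univ, smul_eq_mul]
    rw [← Finset.mul_sum, Finset.sum_comm]
    -- Each valid item is sent to exactly one database.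
    have h2 : ∀ v : Fin K → Fin (r + 1), ∑ n, (if Item.IsValid (k, v) then
        (if Item.database (k, v) = n then 1 else 0) else 0) =
        if Item.IsValid (k, v) then 1 else 0 := by
      intro v
      split_ifs <;> simp
    simp only [h2]
    rw [← Finset.card_filter]
    have h3 : (r + 1) ^ (k : ℕ) * (r + 1) ^ (K - (k + 1)) = ℓ := by
      rw [← pow_add, hℓ]
      congr 1
      have := k.2
      omega
    have h4 := card_isValid (r := r) k
    rw [h4, mul_left_comm, h3, mul_comm]

end ProjectiveScheme

/-! ### The capacity formula and the comparison with the classical capacity. -/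

section Capacity

variable {F : Type*} [Field F] {N K : ℕ} {L : Fin K → ℕ} {p : Fin K → ℝ}

/-- The semantic capacity formula `E[L] / ∑ i, L i / N ^ i`. -/
noncomputable def capacityFormula (N : ℕ) (p : Fin K → ℝ) (L : Fin K → ℕ) : ℝ≥0∞ :=
  ENNReal.ofReal (expectedSize p L) /
    ENNReal.ofReal (∑ i : Fin K, (L i : ℝ) / (N : ℝ) ^ (i : ℕ))

lemma exactSizeCapacity_le [Finite F] (hN : 1 ≤ N) (hp : ∀ i, 0 < p i) (hp1 : ∑ i, p i = 1) :
    exactSizeCapacity F N p L ≤ capacityFormula N p L :=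
  iSup_le fun _ => iSup_le fun hc => iSup_le fun hpr =>
    ENNReal.div_le_div_left (sum_div_pow_le_expectedDownload hN hp hp1 hpr hc) _

lemma capacityFormula_mul {m : ℕ} (hm : 0 < m) :
    capacityFormula N p (fun i => m * L i) = capacityFormula N p L := by
  have hm' : (0 : ℝ) < m := by exact_mod_cast hm
  have h1 : expectedSize p (fun i => m * L i) = m * expectedSize p L := by
    rw [expectedSize, expectedSize, Finset.mul_sum]
    exact Finset.sum_congr rfl fun i _ => by push_cast; ring
  have h2 : ∑ i : Fin K, ((m * L i : ℕ) : ℝ) / (N : ℝ) ^ (i : ℕ) =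
      m * ∑ i : Fin K, (L i : ℝ) / (N : ℝ) ^ (i : ℕ) := by
    rw [Finset.mul_sum]
    exact Finset.sum_congr rfl fun i _ => by push_cast; ring
  rw [capacityFormula, capacityFormula, h1, h2, ENNReal.ofReal_mul hm'.le,
    ENNReal.ofReal_mul hm'.le]
  exact ENNReal.mul_div_mul_left _ _ (by simpa using hm.ne') ENNReal.ofReal_ne_top

lemma capacityFormula_le_of_dvd_pow (hN : 1 ≤ N) (hp : ∀ i, 0 < p i) (hp1 : ∑ i, p i = 1)
    (hL : Antitone L) (h : ∀ i, N ^ K ∣ L i) :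
    capacityFormula N p L ≤ exactSizeCapacity F N p L := by
  obtain ⟨r, rfl⟩ : ∃ r, N = r + 1 := ⟨N - 1, by omega⟩
  -- The scheme needs only divisibility by `N ^ (K - 1)`, which the hypothesis implies.
  have h' : ∀ i, L i = L i / (r + 1) ^ (K - 1) * (r + 1) ^ (K - 1) := fun i =>
    (Nat.div_mul_cancel ((pow_dvd_pow _ (Nat.sub_le K 1)).trans (h i))).symm
  rw [funext h']
  exact le_exactSizeCapacity_of_dvd_pow hp hp1 fun i j hij => Nat.div_le_div_right (hL hij)

lemma capacityFormula_le_of_dvd_sub_one (hN : 1 ≤ N) (hp : ∀ i, 0 < p i) (hp1 : ∑ i, p i = 1)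
    (hL : Antitone L) (h : ∀ i, N - 1 ∣ L i) :
    capacityFormula N p L ≤ exactSizeCapacity F N p L := by
  obtain ⟨r, rfl⟩ : ∃ r, N = r + 1 := ⟨N - 1, by omega⟩
  have h' : ∀ i, L i = L i / r * r := fun i => (Nat.div_mul_cancel (h i)).symm
  rw [funext h']
  exact le_exactSizeCapacity_of_dvd_sub_one hp hp1 fun i j hij => Nat.div_le_div_right (hL hij)

/-- The formula is invariant under scaling, so the converse at every scale and the scheme at the
single scale `N ^ K` meet. -/
lemma semanticCapacity_eq [Finite F] (hN : 1 ≤ N) (hp : ∀ i, 0 < p i) (hp1 : ∑ i, p i = 1)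
    (hL : Antitone L) : semanticCapacity F N p L = capacityFormula N p L := by
  refine le_antisymm (iSup_le fun m => iSup_le fun hm => ?_) ?_
  · exact (exactSizeCapacity_le hN hp hp1).trans_eq (capacityFormula_mul hm)
  · have hm : 0 < N ^ K := Nat.pow_pos (by omega)
    rw [← capacityFormula_mul hm]
    exact le_iSup_of_le (N ^ K) (le_iSup_of_le hm (capacityFormula_le_of_dvd_pow hN hp hp1
      (fun i j hij => Nat.mul_le_mul_left _ (hL hij)) fun i => Dvd.intro _ rfl))

lemma classicalCapacity_lt_capacityFormula_iff (hN : 1 ≤ N) (hp : ∀ i, 0 < p i)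
    (hp1 : ∑ i, p i = 1) (hL : ∀ i, 0 < L i) :
    ENNReal.ofReal (classicalCapacity N K) < capacityFormula N p L ↔
      ∑ i : Fin K, 1 / (N : ℝ) ^ (i : ℕ) * ((L i : ℝ) - expectedSize p L) < 0 := by
  have hN0 : (0 : ℝ) < N := by exact_mod_cast hN
  have hne : (Finset.univ : Finset (Fin K)).Nonempty := by
    by_contra h
    rw [Finset.not_nonempty_iff_eq_empty.mp h] at hp1
    simp at hp1
  have hL' : ∀ i, (0 : ℝ) < L i := fun i => by exact_mod_cast hL i
  have hE : 0 < expectedSize p L := Finset.sum_pos (fun i _ => mul_pos (hp i) (hL' i)) hne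
  have hD : 0 < ∑ i : Fin K, (L i : ℝ) / (N : ℝ) ^ (i : ℕ) :=
    Finset.sum_pos (fun i _ => div_pos (hL' i) (pow_pos hN0 _)) hne
  have hC : 0 < ∑ i : Fin K, 1 / (N : ℝ) ^ (i : ℕ) :=
    Finset.sum_pos (fun i _ => div_pos one_pos (pow_pos hN0 _)) hne
  have hsum : ∑ i : Fin K, 1 / (N : ℝ) ^ (i : ℕ) * ((L i : ℝ) - expectedSize p L) =
      ∑ i : Fin K, (L i : ℝ) / (N : ℝ) ^ (i : ℕ) -
        expectedSize p L * ∑ i : Fin K, 1 / (N : ℝ) ^ (i : ℕ) := by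
    rw [Finset.mul_sum, ← Finset.sum_sub_distrib]
    exact Finset.sum_congr rfl fun i _ => by ring
  rw [classicalCapacity, ← Fin.sum_univ_eq_sum_range (fun i => 1 / (N : ℝ) ^ i), capacityFormula,
    ← ENNReal.ofReal_div_of_pos hD, ENNReal.ofReal_lt_ofReal_iff (div_pos hE hD), hsum,
    inv_eq_one_div, div_lt_div_iff₀ hC hD, one_mul, sub_neg]

lemma sum_mul_sub_expectedSize_eq (hp1 : ∑ i, p i = 1) :
    ∑ i : Fin K, 1 / (N : ℝ) ^ (i : ℕ) * ((L i : ℝ) - expectedSize p L) =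
      ∑ i : Fin K, ∑ j : Fin K, p j / (N : ℝ) ^ (i : ℕ) * ((L i : ℝ) - (L j : ℝ)) := by
  refine Finset.sum_congr rfl fun i _ => ?_
  have h : (L i : ℝ) - expectedSize p L = ∑ j, p j * ((L i : ℝ) - L j) := by
    simp only [mul_sub, Finset.sum_sub_distrib, ← Finset.sum_mul, hp1, one_mul, expectedSize]
  rw [h, Finset.mul_sum]
  exact Finset.sum_congr rfl fun j _ => by ring

end Capacity

theorem corollary1 {F : Type*} [Field F] [Finite F] (N K : ℕ) (hN : 1 ≤ N)
    (p : Fin K → ℝ) (hp : ∀ i, 0 < p i) (hp1 : ∑ i, p i = 1)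
    (L : Fin K → ℕ) (hL : ∀ i, 0 < L i) (hmono : Antitone L) :
    (ENNReal.ofReal (classicalCapacity N K) < semanticCapacity F N p L ↔
      ∑ i : Fin K, 1 / (N : ℝ) ^ (i : ℕ) * ((L i : ℝ) - expectedSize p L) < 0) ∧
    ((∑ i : Fin K, 1 / (N : ℝ) ^ (i : ℕ) * ((L i : ℝ) - expectedSize p L) < 0) ↔
      ∑ i : Fin K, ∑ j : Fin K, p j / (N : ℝ) ^ (i : ℕ) * ((L i : ℝ) - (L j : ℝ)) < 0) ∧
    (((∀ i, N ^ K ∣ L i) ∨ (∀ i, (N - 1) ∣ L i)) →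
      (ENNReal.ofReal (classicalCapacity N K) < exactSizeCapacity F N p L ↔
        ∑ i : Fin K, 1 / (N : ℝ) ^ (i : ℕ) * ((L i : ℝ) - expectedSize p L) < 0)) := by
  refine ⟨?_, ?_, fun h => ?_⟩
  · rw [semanticCapacity_eq hN hp hp1 hmono, classicalCapacity_lt_capacityFormula_iff hN hp hp1 hL]
  · rw [sum_mul_sub_expectedSize_eq hp1]
  · have hC : exactSizeCapacity F N p L = capacityFormula N p L :=
      le_antisymm (exactSizeCapacity_le hN hp hp1)
        (h.elim (capacityFormula_le_of_dvd_pow hN hp hp1 hmono)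
          (capacityFormula_le_of_dvd_sub_one hN hp hp1 hmono))
    rw [hC, classicalCapacity_lt_capacityFormula_iff hN hp hp1 hL]
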